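/- Graphs are finite, simple, undirected, unlabeled, with vertex set $[n]=\{1,\dots,n\}$ ($n$-order graphs), and are identified with their adjacency matrices; $\mathfrak{A}_n$ denotes the set of all of them. A property holds for almost all graphs (in the sense of Babai, Erdős and Selkow) if it fails for only $o(2^{\binom n2})$ of the $2^{\binom n2}$ graphs on $[n]$ as $n\to\infty$. A function $f\colon\mathfrak{A}_n\to\mathbb{R}^d$ is permutation-invariant if it takes equal values on adjacency matrices that differ by a simultaneous permutation of rows and columns, and it is 1-WL-equivalent if, for all $A,B\in\mathfrak{A}_n$, $f(A)\neq f(B)$ exactly when the 1-dimensional Weisfeiler–Leman algorithm (color refinement started from the constant coloring) distinguishes $A$ and $B$. An upstream MPNN assigns to each graph $G$ symmetric priors $\theta(G)\in\mathbb{R}^{n\times n}$ as follows: $h_v^{(0)}=(1,\dots,1)\in\mathbb{R}^m$, $h_v^{(t)}=\mathsf{UPD}^{(t)}\bigl(h_v^{(t-1)},\mathsf{AGG}^{(t)}(\{\!\{h_u^{(t-1)}: u\in N(v)\}\!\})\bigr)\in\mathbb{R}^m$ for $1\le t\le T$, and $\theta(G)_{ij}=\phi(\{\!\{h_i^{(T)},h_j^{(T)}\}\!\})$,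 where $m\geq 1$, $T\ge 0$ and the functions $\mathsf{UPD}^{(t)}$, $\mathsf{AGG}^{(t)}$, $\phi$ are arbitrary and do not depend on $G$. For $\theta\in\mathbb{R}^{n\times n}$ put $p_\theta(S)=\prod_{i,j=1}^n p_{\theta_{ij}}(S_{ij})$ with $p_{\theta_{ij}}(1)=\mathrm{sigmoid}(\theta_{ij})$ and $p_{\theta_{ij}}(0)=1-\mathrm{sigmoid}(\theta_{ij})$. For a graph $C$ of candidate edges and $k\le|E(C)|$, the exactly-$k$ distribution $p^{C}_{(\theta,k)}$ is $p_\theta$ conditioned on the set of graphs $S$ on $[n]$ that have exactly $k$ edges, all of them in $C$. **Theorem.** For every fixed $k$, almost all graphs have at least $k$ edges. Moreover, almost all graphs $G$ have the following property, where $n$ denotes the order of $G$. For every $\varepsilon\in(0,1)$, every $k$ with $0<k\le|E(G)|$, every graph $H$ on $[n]$ isomorphic to $G$, every $d>0$ and every permutation-invariant, 1-WL-equivalent function $f\colon\mathfrak{A}_n\to\mathbb{R}^d$, there is an upstream MPNN, with priors $\theta(\cdot)$, such that the exactly-$k$ distribution, used to remove edges, separates $G$ and $H$ with probability at most $\varepsilon$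 with respect to $f$. That is, for independent $S\sim p_{(\theta(G),k)}$ and $T\sim p_{(\theta(H),k)}$, $$\Pr\bigl[f(G\setminus S)\neq f(H\setminus T)\bigr]\le\varepsilon ,$$ where $G\setminus S$ is $G$ with the edges of $S$ deleted. The same MPNN achieves this bound for both conventions for the candidate edges: when the $k$ edges are sampled among the edges of the input graph ($C=G$ for $S$ and $C=H$ for $T$), and when they are sampled among all vertex pairs ($C$ complete for both). -/

import Mathlib

open Filter Topology

noncomputable section

namespace PRMPNN

/-- The type of colors of iteration `t` of the 1-dimensional Weisfeiler-Leman algorithm on unlabeled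
graphs. The pair (old color, multiset of the old colors of the neighbors) is itself used as the
new color, which is an injective relabeling common to all graphs. -/
def WLColor : ℕ → Type
  | 0 => Unit
  | t + 1 => WLColor t × Multiset (WLColor t)

open Classical in
/-- The 1-WL coloring of the vertices of `G` after `t` iterations. -/
def wlColoring {n : ℕ} (G : SimpleGraph (Fin n)) : (t : ℕ) → Fin n → WLColor t
  | 0 => fun _ => ()
  | t + 1 => fun v => (wlColoring G t v, (G.neighborFinset v).val.map (wlColoring G t))

/-- 1-WL, run in parallel on `G` and `H`, distinguishes them: at some iteration some color occurs
a different number of times. -/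
def WLDistinguishes {n : ℕ} (G H : SimpleGraph (Fin n)) : Prop :=
  ∃ (t : ℕ) (c : WLColor t),
    {v | wlColoring G t v = c}.ncard ≠ {v | wlColoring H t v = c}.ncard

/-- A function on `n`-order graphs is 1-WL-equivalent if it takes different values on exactly those
pairs of graphs that 1-WL distinguishes. -/
def WLEquivalent {n d : ℕ} (f : SimpleGraph (Fin n) → EuclideanSpace ℝ (Fin d)) : Prop :=
  ∀ G H : SimpleGraph (Fin n), f G = f H ↔ ¬ WLDistinguishes G H

/-- Invariance under renaming the vertices, i.e. under simultaneous permutations of the rows and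
columns of the adjacency matrix. -/
def PermInvariant {n d : ℕ} (f : SimpleGraph (Fin n) → EuclideanSpace ℝ (Fin d)) : Prop :=
  ∀ (σ : Equiv.Perm (Fin n)) (G : SimpleGraph (Fin n)), f (G.comap σ) = f G

/-- An upstream message-passing graph neural network of width `m`: in layer `t` every vertex
updates its feature by `upd t` from its old feature and from the aggregate `agg t` of the multiset
of its neighbors' features. After `depth` layers, the prior of a vertex pair is read off from the
unordered pair of the two features. -/
structure UpstreamMPNN (m : ℕ) where
  depth : ℕ
  upd : ℕ → EuclideanSpace ℝ (Fin m) → EuclideanSpace ℝ (Fin m) → EuclideanSpace ℝ (Fin m)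
  agg : ℕ → Multiset (EuclideanSpace ℝ (Fin m)) → EuclideanSpace ℝ (Fin m)
  edgeReadout : Sym2 (EuclideanSpace ℝ (Fin m)) → ℝ

namespace UpstreamMPNN

open Classical in
/-- Vertex features after `t` layers. As the graphs carry no attributes, all initial features
are the all-ones vector. -/
def feature {m n : ℕ} (U : UpstreamMPNN m) (G : SimpleGraph (Fin n)) :
    ℕ → Fin n → EuclideanSpace ℝ (Fin m)
  | 0 => fun _ => WithLp.toLp 2 (fun _ => 1)
  | t + 1 => fun v =>
      U.upd (t + 1) (U.feature G t v)
        (U.agg (t + 1) ((G.neighborFinset v).val.map (U.feature G t)))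

/-- The matrix `θ` of (unnormalized) priors computed from the graph `G`. -/
def priors {m n : ℕ} (U : UpstreamMPNN m) (G : SimpleGraph (Fin n)) : Fin n → Fin n → ℝ :=
  fun i j => U.edgeReadout s(U.feature G U.depth i, U.feature G U.depth j)

end UpstreamMPNN

open Classical in
/-- The unconstrained product weight `p_θ(A(S)) = ∏_{i,j} p_{θ_ij}(A(S)_ij)`, with
`p_{θ_ij}(1) = sigmoid θ_ij` and `p_{θ_ij}(0) = 1 - sigmoid θ_ij`. -/
def edgeWeight {n : ℕ} (θ : Fin n → Fin n → ℝ) (S : SimpleGraph (Fin n)) : ℝ :=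
  ∏ i, ∏ j, if S.Adj i j then Real.sigmoid (θ i j) else 1 - Real.sigmoid (θ i j)

open Classical in
/-- The exactly-`k` probability mass function `p_(θ,k)`: the weight `p_θ` conditioned on having
exactly `k` edges, all of them in the graph `C` of candidate edges. For `C = ⊤` it is supported on
all `k`-edge graphs on the vertex set; for `C = G` on the `k`-element sets of edges of `G`. -/
def exactlyK {n : ℕ} (C : SimpleGraph (Fin n)) (θ : Fin n → Fin n → ℝ) (k : ℕ)
    (S : SimpleGraph (Fin n)) : ℝ :=
  if S ≤ C ∧ S.edgeSet.ncard = k then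
    edgeWeight θ S / ∑ B : SimpleGraph (Fin n) with B ≤ C ∧ B.edgeSet.ncard = k, edgeWeight θ B
  else 0

open Classical in
/-- The probability that `f (G \ S) ≠ f (H \ T)` (removal of the sampled edges) for independent
samples `S` and `T` with probability mass functions `p` and `q`. -/
def separationProb {n d : ℕ} (f : SimpleGraph (Fin n) → EuclideanSpace ℝ (Fin d))
    (G H : SimpleGraph (Fin n)) (p q : SimpleGraph (Fin n) → ℝ) : ℝ :=
  ∑ S, ∑ T, p S * q T * (if f (G \ S) ≠ f (H \ T) then 1 else 0)

/-- `P` holds for almost all graphs: for all but `o(2^(n choose 2))` of the `2^(n choose 2)` graphs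
on `n` labeled vertices. -/
def AlmostAllGraphs (P : (n : ℕ) → SimpleGraph (Fin n) → Prop) : Prop :=
  Tendsto (fun n : ℕ => ({G : SimpleGraph (Fin n) | ¬ P n G}.ncard : ℝ) / 2 ^ (n.choose 2))
    atTop (𝓝 0)

end PRMPNN

end

/-
For almost all graphs, two rounds of color refinement already give all vertices distinct colors,
i.e. no two vertices have the same multiset of neighbor degrees. If `u` and `v` had the same
multiset, then in each degree class exactly half of the vertices adjacent to only one of `u` and `v`
would be adjacent to `u`. Exchanging, at a random set of vertices, the adjacencies to `u` and to `v`
changes none of these degrees but re-randomizes which of these vertices are adjacent to `u`, so the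
event has probability at most `2 ^ (-L)`, where `L` is the number of degrees that occur among them.
Few pairs of vertices have equal degrees, so degree classes are small, and `L` is large enough for a
union bound over all pairs.

On such a graph `G`, a two-layer network with injective aggregation identifies every vertex and can
therefore output any symmetric priors, in particular large ones on a chosen `k`-edge subgraph `S`
and very negative ones elsewhere, which makes the sampled graph equal to `S` with probability close
to `1`. By equivariance, the graph sampled for `H` is then, with probability close to `1`, the image
`T` of `S` under an isomorphism from `G` to `H`, which maps `G \ S` onto `H \ T`.
-/

noncomputable section

namespace PRMPNN

open Finset
open scoped symmDiff BigOperators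

/-- The probability of the event `P` at a uniformly distributed point of the finite type `Ω`. -/
def uniformProb {Ω : Type*} (P : Ω → Prop) : ℝ :=
  {ω | P ω}.ncard / Nat.card Ω

section UniformProb

variable {Ω Ω' ι : Type*}

lemma uniformProb_mono [Finite Ω] {P Q : Ω → Prop} (h : ∀ ω, P ω → Q ω) :
    uniformProb P ≤ uniformProb Q := by
  unfold uniformProb
  gcongr
  · exact Set.toFinite _
  · exact h _

lemma uniformProb_eq_expect [Fintype Ω] (P : Ω → Prop) [DecidablePred P] :
    uniformProb P = 𝔼 ω, if P ω then 1 else 0 := by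
  rw [uniformProb, ← coe_filter_univ, Set.ncard_coe_finset, Nat.card_eq_fintype_card,
    Fintype.expect_eq_sum_div_card, sum_boole]

lemma uniformProb_comp [Finite Ω] [Finite Ω'] {e : Ω → Ω'} (he : Function.Bijective e)
    (P : Ω' → Prop) :
    uniformProb (fun ω => P (e ω)) = uniformProb P := by
  classical
  have := Fintype.ofFinite Ω
  have := Fintype.ofFinite Ω'
  simp only [uniformProb_eq_expect]
  exact Fintype.expect_bijective e he _ _ fun _ => rfl

lemma uniformProb_le_of_family_bijective [Finite Ω] [Finite Ω'] [Nonempty Ω] [Nonempty Ω']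
    {P : Ω → Prop} {e : Ω' → Ω → Ω} (he : ∀ x, Function.Bijective (e x)) {p : ℝ}
    (h : ∀ ω, uniformProb (fun x => P (e x ω)) ≤ p) : uniformProb P ≤ p := by
  classical
  have := Fintype.ofFinite Ω
  have := Fintype.ofFinite Ω'
  calc uniformProb P = 𝔼 x, uniformProb fun ω => P (e x ω) := by
        simp only [uniformProb_comp (he _), Fintype.expect_const]
    _ = 𝔼 ω, uniformProb fun x => P (e x ω) := by
        simp only [uniformProb_eq_expect]
        exact expect_comm ..
    _ ≤ 𝔼 _ω : Ω, p := expect_le_expect fun ω _ => h ω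
    _ = p := Fintype.expect_const p

lemma mul_uniformProb_le_card_filter_le [Finite Ω] (s : Finset ι) (P : ι → Ω → Prop)
    [∀ i ω, Decidable (P i ω)] (c : ℕ) :
    c * uniformProb (fun ω => c ≤ #{i ∈ s | P i ω}) ≤ ∑ i ∈ s, uniformProb (P i) := by
  have := Fintype.ofFinite Ω
  have hsum : ∑ i ∈ s, uniformProb (P i) = 𝔼 ω, (#{i ∈ s | P i ω} : ℝ) := by
    simp only [uniformProb_eq_expect, ← expect_sum_comm, natCast_card_filter]
  rw [hsum, uniformProb_eq_expect, mul_expect]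
  refine expect_le_expect fun ω _ => ?_
  split_ifs with h
  · simpa using h
  · simp

lemma uniformProb_exists_le [Finite Ω] (s : Finset ι) (P : ι → Ω → Prop) :
    uniformProb (fun ω => ∃ i ∈ s, P i ω) ≤ ∑ i ∈ s, uniformProb (P i) := by
  classical
  simpa [Nat.one_le_iff_ne_zero, Finset.filter_eq_empty_iff] using
    mul_uniformProb_le_card_filter_le s P 1

lemma uniformProb_or_le (P Q : Ω → Prop) :
    uniformProb (fun ω => P ω ∨ Q ω) ≤ uniformProb P + uniformProb Q := by
  unfold uniformProb
  rw [← add_div]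
  gcongr
  exact_mod_cast Set.ncard_union_le {ω | P ω} {ω | Q ω}

lemma uniformProb_le_inv_card_of_subsingleton [Finite Ω] {P : Ω → Prop}
    (h : {ω | P ω}.Subsingleton) :
    uniformProb P ≤ 1 / Nat.card Ω := by
  unfold uniformProb
  gcongr
  exact_mod_cast Set.ncard_le_one_iff_subsingleton.2 h

end UniformProb

section Binomial

lemma centralBinom_sq_mul_le (m : ℕ) : m.centralBinom ^ 2 * (2 * m + 1) ≤ 16 ^ m := by
  induction m with
  | zero => simp
  | succ m ih =>
    refine Nat.le_of_mul_le_mul_left ?_ (show 0 < (m + 1) ^ 2 by positivity)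
    calc (m + 1) ^ 2 * ((m + 1).centralBinom ^ 2 * (2 * (m + 1) + 1))
        = ((m + 1) * (m + 1).centralBinom) ^ 2 * (2 * m + 3) := by ring
      _ = (m.centralBinom ^ 2 * (2 * m + 1)) * (4 * ((2 * m + 1) * (2 * m + 3))) := by
        rw [Nat.succ_mul_centralBinom_succ]; ring
      _ ≤ 16 ^ m * (4 * (4 * (m + 1) ^ 2)) := Nat.mul_le_mul ih (by nlinarith)
      _ = (m + 1) ^ 2 * 16 ^ (m + 1) := by ring

lemma choose_sq_mul_le (N j : ℕ) : N.choose j ^ 2 * N ≤ 4 ^ N := by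
  obtain ⟨m, rfl | rfl⟩ := N.even_or_odd'
  · calc (2 * m).choose j ^ 2 * (2 * m) ≤ m.centralBinom ^ 2 * (2 * m + 1) := by
          gcongr
          · exact Nat.choose_le_centralBinom j m
          · lia
      _ ≤ 16 ^ m := centralBinom_sq_mul_le m
      _ = 4 ^ (2 * m) := by rw [pow_mul]; norm_num
  · have h : (2 * m + 1).choose j ≤ 2 * m.centralBinom := by
      cases j with
      | zero => have := m.centralBinom_pos; simp only [Nat.choose_zero_right]; lia
      | succ j =>
        rw [Nat.choose_succ_succ', two_mul m.centralBinom]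
        exact add_le_add (Nat.choose_le_centralBinom j m) (Nat.choose_le_centralBinom (j + 1) m)
    calc (2 * m + 1).choose j ^ 2 * (2 * m + 1)
        ≤ (2 * m.centralBinom) ^ 2 * (2 * m + 1) := by gcongr
      _ = 4 * (m.centralBinom ^ 2 * (2 * m + 1)) := by ring
      _ ≤ 4 * 16 ^ m := by gcongr; exact centralBinom_sq_mul_le m
      _ = 4 ^ (2 * m + 1) := by rw [pow_succ, pow_mul]; norm_num; ring

lemma choose_le_two_pow_div_sqrt {N : ℕ} (hN : 0 < N) (j : ℕ) :
    (N.choose j : ℝ) ≤ 2 ^ N / √N := by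
  rw [le_div_iff₀ (by positivity)]
  refine le_of_sq_le_sq ?_ (by positivity)
  rw [mul_pow, Real.sq_sqrt N.cast_nonneg, pow_right_comm]
  norm_num
  exact_mod_cast choose_sq_mul_le N j

end Binomial

section RandomSubset

variable {α : Type*} [Finite α]

lemma natCard_finset : Nat.card (Finset α) = 2 ^ Nat.card α := by
  have := Fintype.ofFinite α
  simp

lemma uniformProb_symmDiff [DecidableEq α] (P : Finset α → Prop) (t : Finset α) :
    uniformProb (fun s => P (t ∆ s)) = uniformProb P :=
  uniformProb_comp (symmDiff_right_involutive t).bijective P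

lemma uniformProb_card_eq (j : ℕ) :
    uniformProb (fun s : Finset α => #s = j) = (Nat.card α).choose j / 2 ^ Nat.card α := by
  have := Fintype.ofFinite α
  have h : {s : Finset α | #s = j}.ncard = (Nat.card α).choose j := by
    rw [Nat.card_eq_fintype_card, ← card_univ, ← card_powersetCard, ← Set.ncard_coe_finset]
    congr 1
    ext s
    simp
  rw [uniformProb, h, natCard_finset]
  norm_cast

lemma uniformProb_card_eq_le [Nonempty α] (j : ℕ) :
    uniformProb (fun s : Finset α => #s = j) ≤ 1 / √(Nat.card α) := by
  rw [uniformProb_card_eq, div_le_iff₀ (by positivity), one_div_mul_eq_div]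
  exact choose_le_two_pow_div_sqrt Nat.card_pos j

lemma uniformProb_card_lt_le [Nonempty α] (r : ℕ) :
    uniformProb (fun s : Finset α => #s < r) ≤ r * (Nat.card α) ^ r / 2 ^ Nat.card α := by
  calc uniformProb (fun s : Finset α => #s < r)
      ≤ uniformProb (fun s : Finset α => ∃ j ∈ range r, #s = j) :=
        uniformProb_mono fun s hs => ⟨#s, mem_range.2 hs, rfl⟩
    _ ≤ ∑ j ∈ range r, uniformProb (fun s : Finset α => #s = j) := uniformProb_exists_le _ _
    _ ≤ ∑ j ∈ range r, (Nat.card α : ℝ) ^ r / 2 ^ Nat.card α := by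
      refine sum_le_sum fun j hj => ?_
      rw [uniformProb_card_eq]
      gcongr
      exact_mod_cast (Nat.choose_le_pow _ _).trans
        (Nat.pow_le_pow_right Nat.card_pos (mem_range.1 hj).le)
    _ = r * (Nat.card α) ^ r / 2 ^ Nat.card α := by
      rw [sum_const, card_range, nsmul_eq_mul, mul_div_assoc]

end RandomSubset

section Fibers

variable {α β : Type*} [DecidableEq α] [DecidableEq β] {c : α → β} {R D y z : Finset α}

lemma subset_of_card_fiber_eq (hc : Set.InjOn c R) (hyz : y ∆ z ⊆ R)
    (h : ∀ k, #{w ∈ D | c w = k ∧ w ∈ y} = #{w ∈ D | c w = k ∧ w ∈ z}) (hRD : R ⊆ D) :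
    y ⊆ z := by
  intro w hwy
  by_contra hwz
  have hwR : w ∈ R := hyz (mem_symmDiff.2 (.inl ⟨hwy, hwz⟩))
  have hsub : {x ∈ D | c x = c w ∧ x ∈ z} ⊆ {x ∈ D | c x = c w ∧ x ∈ y} := by
    intro x hx
    rw [mem_filter] at hx ⊢
    refine ⟨hx.1, hx.2.1, by_contra fun hxy => hwz ?_⟩
    have hxR : x ∈ R := hyz (mem_symmDiff.2 (.inr ⟨hx.2.2, hxy⟩))
    exact hc hxR hwR hx.2.1 ▸ hx.2.2
  have heq := eq_of_subset_of_card_le hsub (h (c w)).le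
  have hmem : w ∈ ({x ∈ D | c x = c w ∧ x ∈ z} : Finset α) := by simp [heq, hRD hwR, hwy]
  exact hwz (mem_filter.1 hmem).2.2

lemma eq_of_card_fiber_eq (hc : Set.InjOn c R) (hyz : y ∆ z ⊆ R)
    (h : ∀ k, #{w ∈ D | c w = k ∧ w ∈ y} = #{w ∈ D | c w = k ∧ w ∈ z}) (hRD : R ⊆ D) :
    y = z :=
  (subset_of_card_fiber_eq hc hyz h hRD).antisymm
    (subset_of_card_fiber_eq hc (symmDiff_comm y z ▸ hyz) (fun k => (h k).symm) hRD)

-- Given the trace of `y` outside a transversal of the fibers, at most one choice on the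
-- transversal realizes all the prescribed cardinalities.
lemma uniformProb_card_fiber_eq_le [Finite α] (D : Finset α) (c : α → β) (h : β → ℕ) :
    uniformProb (fun y : Finset α => ∀ k, #{w ∈ D | c w = k ∧ w ∈ y} = h k) ≤
      1 / 2 ^ #(D.image c) := by
  obtain ⟨R, hRD, hc, himage⟩ :=
    exists_subset_injOn_image_eq_of_surjOn (D : Set α) (D.image c)
      (by rw [coe_image]; exact Set.surjOn_image _ _)
  have hcard : Nat.card (Finset R) = 2 ^ #(D.image c) := by
    rw [natCard_finset, ← himage, card_image_of_injOn hc, Nat.card_eq_fintype_card,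
      Fintype.card_coe]
  refine uniformProb_le_of_family_bijective
    (e := fun (s : Finset R) y => s.map (.subtype _) ∆ y)
    (fun s => (symmDiff_right_involutive _).bijective) fun y => ?_
  refine (uniformProb_le_inv_card_of_subsingleton fun s hs t ht => ?_).trans_eq
    (by rw [hcard]; norm_cast)
  have hst : (s.map (.subtype _) ∆ y) ∆ (t.map (.subtype _) ∆ y) ⊆ R := by
    rw [symmDiff_symmDiff_symmDiff_comm, symmDiff_self, symmDiff_bot]
    exact fun w hw => (mem_symmDiff.1 hw).elim (fun h => property_of_mem_map_subtype s h.1)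
      fun h => property_of_mem_map_subtype t h.1
  have := eq_of_card_fiber_eq hc hst (fun k => (hs k).trans (ht k).symm) (by exact_mod_cast hRD)
  exact map_injective _ (symmDiff_left_injective _ this)

end Fibers

lemma card_symmDiff_map_subtype {α : Type*} [DecidableEq α] (p : α → Prop) [DecidablePred p]
    (s : Finset α) (x : Finset (Subtype p)) :
    #(s ∆ x.map (.subtype p)) = #(s.subtype p ∆ x) + #{w ∈ s | ¬p w} := by
  rw [← card_filter_add_card_filter_not p, ← card_map (.subtype p) (s := s.subtype p ∆ x)]
  congr 2 <;> ext w <;> by_cases hw : p w <;> simp [mem_symmDiff, hw]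

section DegreeProfile

variable {V : Type*} [Fintype V] {G : SimpleGraph V} {u v w : V}

open Classical in
/-- The multiset of the degrees of the neighbors of `v`. This is the color that `v` receives in the
second round of color refinement. -/
def neighborDegrees (G : SimpleGraph V) (v : V) : Multiset ℕ :=
  (G.neighborFinset v).val.map fun w => G.degree w

/-- Distinct vertices have distinct multisets of neighbor degrees, i.e. two rounds of color
refinement produce a discrete coloring. -/
def NeighborDegreesSeparate (G : SimpleGraph V) : Prop :=
  Function.Injective (neighborDegrees G)

open Classical in
/-- The vertices other than `u` and `v` that are adjacent to exactly one of `u` and `v`. -/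
def exclusiveNeighbors (G : SimpleGraph V) (u v : V) : Finset V :=
  {w | w ≠ u ∧ w ≠ v ∧ ¬(G.Adj u w ↔ G.Adj v w)}

lemma mem_exclusiveNeighbors :
    w ∈ exclusiveNeighbors G u v ↔ w ≠ u ∧ w ≠ v ∧ ¬(G.Adj u w ↔ G.Adj v w) := by
  simp [exclusiveNeighbors]

end DegreeProfile

section Toggling

variable {V : Type*} {G : SimpleGraph V} {u v a b : V} {y : Finset V}

/-- The graph whose edges join `u` to the vertices of `y`. Taking the symmetric difference with it
toggles the adjacency of `u` to the vertices of `y`. -/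
def spokes (u : V) (y : Finset V) : SimpleGraph V :=
  .fromRel fun a b => a = u ∧ b ∈ y

lemma symmDiff_spokes_adj (hu : u ∉ y) :
    (G ∆ spokes u y).Adj u b ↔ ¬(G.Adj u b ↔ b ∈ y) := by
  have : b ∈ y → u ≠ b := fun hb h => hu (h ▸ hb)
  simp only [symmDiff_def, SimpleGraph.sup_adj, SimpleGraph.sdiff_adj, spokes,
    SimpleGraph.fromRel_adj]
  grind

lemma symmDiff_spokes_adj_of_ne (hau : a ≠ u) (hay : a ∉ y) :
    (G ∆ spokes u y).Adj a b ↔ G.Adj a b := by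
  simp [symmDiff_def, spokes, hau, hay]

lemma uniformProb_le_of_toggle [Finite V] {P : SimpleGraph V → Prop} {p : ℝ}
    (h : ∀ G, uniformProb (fun x : Finset {w // w ≠ u ∧ w ≠ v} =>
      P (G ∆ spokes u (x.map (.subtype _)))) ≤ p) :
    uniformProb P ≤ p :=
  uniformProb_le_of_family_bijective (fun _ => (symmDiff_left_involutive _).bijective) h

lemma left_notMem_map (x : Finset {w // w ≠ u ∧ w ≠ v}) : u ∉ x.map (.subtype _) := by simp

lemma right_notMem_map (x : Finset {w // w ≠ u ∧ w ≠ v}) : v ∉ x.map (.subtype _) := by simp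

variable [Fintype V] {n : ℕ}

lemma natCard_ne_ne (huv : u ≠ v) (hn : Fintype.card V = n + 2) :
    Nat.card {w // w ≠ u ∧ w ≠ v} = n := by
  classical
  have : ({w | w ≠ u ∧ w ≠ v} : Finset V) = univ \ {u, v} := by ext w; simp
  rw [Nat.card_eq_fintype_card, Fintype.card_subtype, this, card_univ_sdiff, card_pair huv, hn]
  rfl

open Classical in
lemma neighborFinset_symmDiff_spokes (hu : u ∉ y) :
    (G ∆ spokes u y).neighborFinset u = G.neighborFinset u ∆ y := by
  ext b
  rw [SimpleGraph.mem_neighborFinset, symmDiff_spokes_adj hu, mem_symmDiff,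
    SimpleGraph.mem_neighborFinset]
  tauto

open Classical in
lemma degree_symmDiff_spokes_of_ne (hvu : v ≠ u) (hv : v ∉ y) :
    (G ∆ spokes u y).degree v = G.degree v := by
  rw [SimpleGraph.degree, SimpleGraph.degree]
  congr 1
  ext b
  simp only [SimpleGraph.mem_neighborFinset, symmDiff_spokes_adj_of_ne hvu hv]

open Classical in
lemma exclusiveNeighbors_symmDiff_spokes (huv : u ≠ v) (hu : u ∉ y) (hv : v ∉ y) :
    exclusiveNeighbors (G ∆ spokes u y) u v = exclusiveNeighbors G u v ∆ y := by
  ext w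
  rw [mem_symmDiff, mem_exclusiveNeighbors, mem_exclusiveNeighbors, symmDiff_spokes_adj hu,
    symmDiff_spokes_adj_of_ne huv.symm hv]
  grind

open Classical in
lemma uniformProb_degree_eq_le [NeZero n] (huv : u ≠ v) (hn : Fintype.card V = n + 2) :
    uniformProb (fun G : SimpleGraph V => G.degree u = G.degree v) ≤ 1 / √n := by
  have hX := natCard_ne_ne huv hn
  have : Nonempty {w // w ≠ u ∧ w ≠ v} := (Nat.card_pos_iff.1 (hX ▸ NeZero.pos n)).1
  refine uniformProb_le_of_toggle (u := u) (v := v) fun G => ?_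
  let t := (G.neighborFinset u).subtype fun w => w ≠ u ∧ w ≠ v
  let j := G.degree v - #{w ∈ G.neighborFinset u | ¬(w ≠ u ∧ w ≠ v)}
  calc _ ≤ uniformProb (fun x => #(t ∆ x) = j) := uniformProb_mono fun x hx => by
        rw [degree_symmDiff_spokes_of_ne huv.symm (right_notMem_map x), SimpleGraph.degree,
          neighborFinset_symmDiff_spokes (left_notMem_map x), card_symmDiff_map_subtype] at hx
        exact Nat.eq_sub_of_add_eq hx
    _ = uniformProb (fun x : Finset {w // w ≠ u ∧ w ≠ v} => #x = j) :=
        uniformProb_symmDiff (fun x => #x = j) t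
    _ ≤ 1 / √n := hX ▸ uniformProb_card_eq_le j

lemma uniformProb_card_exclusiveNeighbors_lt_le [NeZero n] (huv : u ≠ v)
    (hn : Fintype.card V = n + 2) (r : ℕ) :
    uniformProb (fun G : SimpleGraph V => #(exclusiveNeighbors G u v) < r) ≤
      r * n ^ r / 2 ^ n := by
  classical
  have hX := natCard_ne_ne huv hn
  have : Nonempty {w // w ≠ u ∧ w ≠ v} := (Nat.card_pos_iff.1 (hX ▸ NeZero.pos n)).1
  refine uniformProb_le_of_toggle (u := u) (v := v) fun G => ?_
  let t := (exclusiveNeighbors G u v).subtype fun w => w ≠ u ∧ w ≠ v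
  calc _ ≤ uniformProb (fun x => #(t ∆ x) < r) := uniformProb_mono fun x hx => by
        rw [exclusiveNeighbors_symmDiff_spokes huv (left_notMem_map x) (right_notMem_map x),
          card_symmDiff_map_subtype] at hx
        exact (Nat.le_add_right _ _).trans_lt hx
    _ = uniformProb (fun x : Finset {w // w ≠ u ∧ w ≠ v} => #x < r) :=
        uniformProb_symmDiff (fun x => #x < r) t
    _ ≤ r * n ^ r / 2 ^ n := hX ▸ uniformProb_card_lt_le r

end Toggling

section Exchange

variable {V : Type*} {G : SimpleGraph V} {u v a b w : V} {x : Finset V}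

open Classical in
/-- The permutation applied to the neighbors of `w` in `exchange u v x G`: it swaps `u` and `v` if
`w` is a vertex of `x` other than `u` and `v`, and is trivial otherwise. -/
def exchangePerm (u v : V) (x : Finset V) (w : V) : Equiv.Perm V :=
  if w ∈ x ∧ w ≠ u ∧ w ≠ v then Equiv.swap u v else 1

lemma exchangePerm_involutive (u v : V) (x : Finset V) (w : V) :
    Function.Involutive (exchangePerm u v x w) := by
  classical
  unfold exchangePerm
  split_ifs
  · exact Equiv.swap_apply_self u v
  · exact fun _ => rfl

lemma exchangePerm_apply_of_ne (hbu : b ≠ u) (hbv : b ≠ v) : exchangePerm u v x a b = b := by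
  classical
  unfold exchangePerm
  split_ifs
  · exact Equiv.swap_apply_of_ne_of_ne hbu hbv
  · rfl

lemma exchangePerm_exchangePerm (u v : V) (x : Finset V) (a b : V) :
    exchangePerm u v x (exchangePerm u v x a b) = exchangePerm u v x b := by
  classical
  by_cases h : b = u ∨ b = v
  · have hb : exchangePerm u v x a b = u ∨ exchangePerm u v x a b = v := by
      rcases h with rfl | rfl <;> unfold exchangePerm <;> split_ifs <;> simp
    rw [exchangePerm, if_neg (by tauto), exchangePerm, if_neg (by tauto)]
  · rw [exchangePerm_apply_of_ne (fun h' => h (.inl h')) fun h' => h (.inr h')]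

/-- The graph obtained from `G` by exchanging, for every vertex of `x` other than `u` and `v`, its
adjacency to `u` and its adjacency to `v`. -/
def exchange (u v : V) (x : Finset V) (G : SimpleGraph V) : SimpleGraph V where
  Adj a b := G.Adj (exchangePerm u v x b a) (exchangePerm u v x a b)
  symm.symm _ _ h := h.symm
  loopless.irrefl _ h := G.irrefl h

lemma exchange_adj :
    (exchange u v x G).Adj a b ↔ G.Adj (exchangePerm u v x b a) (exchangePerm u v x a b) :=
  Iff.rfl

lemma exchange_involutive (u v : V) (x : Finset V) :
    Function.Involutive (exchange u v x) := by
  intro G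
  ext a b
  rw [exchange_adj, exchange_adj, exchangePerm_exchangePerm, exchangePerm_exchangePerm,
    exchangePerm_involutive, exchangePerm_involutive]

open Classical in
lemma exchange_adj_left (hwu : w ≠ u) (hwv : w ≠ v) :
    (exchange u v x G).Adj u w ↔ if w ∈ x then G.Adj v w else G.Adj u w := by
  rw [exchange_adj, exchangePerm_apply_of_ne hwu hwv, exchangePerm]
  split_ifs <;> simp_all

open Classical in
lemma exchange_adj_right (hwu : w ≠ u) (hwv : w ≠ v) :
    (exchange u v x G).Adj v w ↔ if w ∈ x then G.Adj u w else G.Adj v w := by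
  rw [exchange_adj, exchangePerm_apply_of_ne hwu hwv, exchangePerm]
  split_ifs <;> simp_all

variable [Fintype V]

open Classical in
lemma degree_exchange (hwu : w ≠ u) (hwv : w ≠ v) :
    (exchange u v x G).degree w = G.degree w := by
  have : (exchange u v x G).neighborFinset w =
      (G.neighborFinset w).map (exchangePerm u v x w).toEmbedding := by
    ext b
    rw [SimpleGraph.mem_neighborFinset, exchange_adj, exchangePerm_apply_of_ne hwu hwv,
      mem_map_equiv, SimpleGraph.mem_neighborFinset,
      (exchangePerm_involutive u v x w).symm_eq_self_of_involutive]
  rw [SimpleGraph.degree, this, card_map, SimpleGraph.degree]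

lemma exclusiveNeighbors_exchange :
    exclusiveNeighbors (exchange u v x G) u v = exclusiveNeighbors G u v := by
  ext w
  simp only [mem_exclusiveNeighbors]
  refine and_congr_right fun hwu => and_congr_right fun hwv => ?_
  rw [exchange_adj_left hwu hwv, exchange_adj_right hwu hwv]
  split_ifs <;> tauto

open Classical in
lemma exchange_adj_left_iff_mem_symmDiff (hw : w ∈ exclusiveNeighbors G u v) :
    (exchange u v x G).Adj u w ↔ w ∈ G.neighborFinset u ∆ x := by
  obtain ⟨hwu, hwv, hw⟩ := mem_exclusiveNeighbors.1 hw
  rw [exchange_adj_left hwu hwv, mem_symmDiff, SimpleGraph.mem_neighborFinset]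
  split_ifs <;> tauto

end Exchange

section NeighborDegrees

variable {V : Type*} [Fintype V] {G : SimpleGraph V} {u v : V}

open Classical in
lemma degree_eq_of_neighborDegrees_eq (h : neighborDegrees G u = neighborDegrees G v) :
    G.degree u = G.degree v := by
  simpa [neighborDegrees] using congrArg Multiset.card h

open Classical in
lemma count_neighborDegrees (k : ℕ) :
    (neighborDegrees G v).count k = #{w ∈ G.neighborFinset v | G.degree w = k} := by
  rw [neighborDegrees, Multiset.count_map, Finset.card, Finset.filter_val]
  simp only [eq_comm]

lemma exclusiveNeighbors_comm (G : SimpleGraph V) (u v : V) :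
    exclusiveNeighbors G u v = exclusiveNeighbors G v u := by
  ext w
  simp only [mem_exclusiveNeighbors]
  tauto

open Classical in
lemma filter_exclusiveNeighbors_adj (G : SimpleGraph V) (u v : V) (k : ℕ) :
    ({w ∈ exclusiveNeighbors G u v | G.degree w = k ∧ G.Adj u w} : Finset V) =
      ({w ∈ G.neighborFinset u | G.degree w = k} \
        {w ∈ G.neighborFinset v | G.degree w = k}).erase v := by
  ext w
  have : G.Adj u w → w ≠ u := fun h => h.ne'
  simp only [mem_filter, mem_exclusiveNeighbors, mem_erase, Finset.mem_sdiff,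
    SimpleGraph.mem_neighborFinset]
  tauto

open Classical in
lemma card_exclusiveNeighbors_adj_eq (h : neighborDegrees G u = neighborDegrees G v) (k : ℕ) :
    #{w ∈ exclusiveNeighbors G u v | G.degree w = k ∧ G.Adj u w} =
      #{w ∈ exclusiveNeighbors G u v | G.degree w = k ∧ G.Adj v w} := by
  nth_rw 2 [exclusiveNeighbors_comm]
  rw [filter_exclusiveNeighbors_adj, filter_exclusiveNeighbors_adj, card_erase_eq_ite,
    card_erase_eq_ite]
  have hcard : #{w ∈ G.neighborFinset u | G.degree w = k} =
      #{w ∈ G.neighborFinset v | G.degree w = k} := by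
    rw [← count_neighborDegrees, ← count_neighborDegrees, h]
  rw [card_sdiff_comm hcard]
  simp [degree_eq_of_neighborDegrees_eq h, G.adj_comm u v]

open Classical in
lemma two_mul_card_exclusiveNeighbors_adj (h : neighborDegrees G u = neighborDegrees G v) (k : ℕ) :
    2 * #{w ∈ exclusiveNeighbors G u v | G.degree w = k ∧ G.Adj u w} =
      #{w ∈ exclusiveNeighbors G u v | G.degree w = k} := by
  have hcompl : {w ∈ exclusiveNeighbors G u v | G.degree w = k ∧ G.Adj v w} =
      {w ∈ exclusiveNeighbors G u v | G.degree w = k ∧ ¬G.Adj u w} :=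
    filter_congr fun w hw => by have := (mem_exclusiveNeighbors.1 hw).2.2; tauto
  rw [two_mul]
  nth_rw 2 [card_exclusiveNeighbors_adj_eq h k]
  rw [hcompl, ← filter_filter, ← filter_filter, card_filter_add_card_filter_not]

-- Exchanging at a random set of vertices keeps the degrees of the exclusive neighbors and
-- randomizes which of them are adjacent to `u`, while equal neighbor degrees at `u` and `v` force
-- exactly half of each degree class to be adjacent to `u`.
open Classical in
lemma uniformProb_neighborDegrees_eq_le (u v : V) (L : ℕ) :
    uniformProb (fun G : SimpleGraph V => neighborDegrees G u = neighborDegrees G v ∧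
      L ≤ #((exclusiveNeighbors G u v).image fun w => G.degree w)) ≤ 1 / 2 ^ L := by
  refine uniformProb_le_of_family_bijective (e := exchange u v)
    (fun x => (exchange_involutive u v x).bijective) fun G => ?_
  set E := exclusiveNeighbors G u v
  have hdeg (x : Finset V) {w : V} (hw : w ∈ E) : (exchange u v x G).degree w = G.degree w :=
    degree_exchange (mem_exclusiveNeighbors.1 hw).1 (mem_exclusiveNeighbors.1 hw).2.1
  have himage (x : Finset V) :
      (exclusiveNeighbors (exchange u v x G) u v).image (fun w => (exchange u v x G).degree w) =
        E.image fun w => G.degree w := by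
    rw [exclusiveNeighbors_exchange]
    exact image_congr fun w hw => hdeg x hw
  simp only [himage]
  by_cases hL : L ≤ #(E.image fun w => G.degree w)
  swap
  · simp [uniformProb, hL]
  let h : ℕ → ℕ := fun k => #{w ∈ E | G.degree w = k} / 2
  calc _ ≤ uniformProb (fun x => ∀ k,
          #{w ∈ E | G.degree w = k ∧ w ∈ G.neighborFinset u ∆ x} = h k) := by
        refine uniformProb_mono fun x hx k => ?_
        have := two_mul_card_exclusiveNeighbors_adj hx.1 k
        rw [exclusiveNeighbors_exchange] at this
        rw [filter_congr fun w hw => by rw [hdeg x hw, exchange_adj_left_iff_mem_symmDiff hw],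
          filter_congr (p := fun w => (exchange u v x G).degree w = k) fun w hw => by
            rw [hdeg x hw]] at this
        lia
    _ = uniformProb (fun x => ∀ k, #{w ∈ E | G.degree w = k ∧ w ∈ x} = h k) :=
        uniformProb_symmDiff (fun x => ∀ k, #{w ∈ E | G.degree w = k ∧ w ∈ x} = h k) _
    _ ≤ 1 / 2 ^ #(E.image fun w => G.degree w) := uniformProb_card_fiber_eq_le ..
    _ ≤ 1 / 2 ^ L := by gcongr; norm_num

end NeighborDegrees

section Separation

variable {V : Type*} [Fintype V] {G : SimpleGraph V} {n : ℕ}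

open Classical in
lemma neighborDegreesSeparate_of_card_degree_le {c L : ℕ}
    (hclass : ∀ d, #{v | G.degree v = d} ≤ c)
    (hexcl : ∀ u v, u ≠ v → L * c ≤ #(exclusiveNeighbors G u v))
    (himage : ∀ u v, u ≠ v → neighborDegrees G u = neighborDegrees G v →
      #((exclusiveNeighbors G u v).image fun w => G.degree w) < L) :
    NeighborDegreesSeparate G := by
  intro u v huv
  by_contra hne
  have hc : 0 < c := (card_pos.2 ⟨u, by simp⟩).trans_le (hclass (G.degree u))
  refine (hexcl u v hne).not_gt ?_
  calc #(exclusiveNeighbors G u v)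
      ≤ c * #((exclusiveNeighbors G u v).image fun w => G.degree w) :=
        card_le_mul_card_image _ _ fun d _ =>
          (card_le_card (filter_subset_filter _ (subset_univ _))).trans (hclass d)
    _ < L * c := by rw [mul_comm]; gcongr; exact himage u v hne huv

open Classical in
lemma sum_offDiag_le {f : V × V → ℝ} {p : ℝ} (hp : 0 ≤ p) (h : ∀ u v, u ≠ v → f (u, v) ≤ p) :
    ∑ e ∈ (univ : Finset V).offDiag, f e ≤ Fintype.card V ^ 2 * p := by
  calc ∑ e ∈ (univ : Finset V).offDiag, f e ≤ #(univ : Finset V).offDiag • p :=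
        sum_le_card_nsmul _ _ _ fun e he => h e.1 e.2 (mem_offDiag.1 he).2.2
    _ ≤ Fintype.card V ^ 2 * p := by
        rw [nsmul_eq_mul]
        gcongr
        rw [offDiag_card, card_univ, sq]
        exact_mod_cast Nat.sub_le _ _

lemma uniformProb_exists_ne_le {P : V → V → SimpleGraph V → Prop} {p : ℝ} (hp : 0 ≤ p)
    (h : ∀ u v, u ≠ v → uniformProb (P u v) ≤ p) :
    uniformProb (fun G => ∃ u v, u ≠ v ∧ P u v G) ≤ Fintype.card V ^ 2 * p := by
  classical
  refine le_trans ?_ ((uniformProb_exists_le univ.offDiag fun e G => P e.1 e.2 G).trans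
    (sum_offDiag_le hp h))
  exact uniformProb_mono fun G ⟨u, v, huv, hP⟩ => ⟨(u, v), by simp [huv], hP⟩

-- Second moment: a degree class with more than `c` vertices contributes at least `c ^ 2` ordered
-- pairs of vertices of equal degree.
open Classical in
lemma sq_mul_uniformProb_exists_lt_card_degree_le [NeZero n] (hn : Fintype.card V = n + 2)
    (c : ℕ) :
    c ^ 2 * uniformProb (fun G : SimpleGraph V => ∃ d, c < #{v | G.degree v = d}) ≤
      Fintype.card V ^ 2 * (1 / √n) := by
  have hpairs (G : SimpleGraph V) (d : ℕ) (hd : c < #{v | G.degree v = d}) :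
      c ^ 2 ≤ #{e ∈ (univ : Finset V).offDiag | G.degree e.1 = G.degree e.2} :=
    calc c ^ 2 ≤ #({v | G.degree v = d} : Finset V).offDiag := by
          rw [offDiag_card, ← Nat.mul_sub_one, sq]
          exact Nat.mul_le_mul hd.le (Nat.le_sub_one_of_lt hd)
      _ ≤ _ := card_le_card fun e he => by
          simp only [mem_offDiag, mem_filter, Finset.mem_univ, true_and] at he ⊢
          exact ⟨he.2.2, he.1.trans he.2.1.symm⟩
  calc _ ≤ ((c ^ 2 : ℕ) : ℝ) * uniformProb (fun G : SimpleGraph V =>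
          c ^ 2 ≤ #{e ∈ (univ : Finset V).offDiag | G.degree e.1 = G.degree e.2}) := by
        push_cast
        gcongr
        exact uniformProb_mono fun G ⟨d, hd⟩ => hpairs G d hd
    _ ≤ ∑ e ∈ (univ : Finset V).offDiag,
          uniformProb (fun G : SimpleGraph V => G.degree e.1 = G.degree e.2) :=
        mul_uniformProb_le_card_filter_le _ _ _
    _ ≤ Fintype.card V ^ 2 * (1 / √n) :=
        sum_offDiag_le (by positivity) fun u v huv => uniformProb_degree_eq_le huv hn

lemma uniformProb_not_neighborDegreesSeparate_le [NeZero n] (hn : Fintype.card V = n + 2)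
    {c : ℕ} (hc : 0 < c) (L : ℕ) :
    uniformProb (fun G : SimpleGraph V => ¬NeighborDegreesSeparate G) ≤
      Fintype.card V ^ 2 *
        (1 / (c ^ 2 * √n) + (L * c : ℕ) * n ^ (L * c) / 2 ^ n + 1 / 2 ^ L) := by
  classical
  let A (G : SimpleGraph V) : Prop := ∃ d, c < #{v | G.degree v = d}
  let B (G : SimpleGraph V) : Prop := ∃ u v, u ≠ v ∧ #(exclusiveNeighbors G u v) < L * c
  let C (G : SimpleGraph V) : Prop := ∃ u v, u ≠ v ∧ neighborDegrees G u = neighborDegrees G v ∧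
    L ≤ #((exclusiveNeighbors G u v).image fun w => G.degree w)
  have hABC (G : SimpleGraph V) (hG : ¬NeighborDegreesSeparate G) : (A G ∨ B G) ∨ C G := by
    contrapose! hG
    simp only [A, B, C, not_exists, not_and, not_lt, not_le] at hG
    exact neighborDegreesSeparate_of_card_degree_le hG.1.1 hG.1.2 hG.2
  have hA : uniformProb A ≤ Fintype.card V ^ 2 * (1 / (c ^ 2 * √n)) := by
    have := sq_mul_uniformProb_exists_lt_card_degree_le hn c
    rw [← le_div_iff₀' (by positivity)] at this
    exact this.trans_eq (by ring)
  have hB : uniformProb B ≤ Fintype.card V ^ 2 * ((L * c : ℕ) * n ^ (L * c) / 2 ^ n) :=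
    uniformProb_exists_ne_le (by positivity) fun u v huv =>
      uniformProb_card_exclusiveNeighbors_lt_le huv hn (L * c)
  have hC : uniformProb C ≤ Fintype.card V ^ 2 * (1 / 2 ^ L) :=
    uniformProb_exists_ne_le (by positivity) fun u v _ => uniformProb_neighborDegrees_eq_le u v L
  calc _ ≤ uniformProb (fun G => (A G ∨ B G) ∨ C G) := uniformProb_mono hABC
    _ ≤ uniformProb A + uniformProb B + uniformProb C :=
        (uniformProb_or_le _ _).trans (add_le_add_left (uniformProb_or_le _ _) _)
    _ ≤ _ := by linarith

end Separation

section AlmostAll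

lemma natCard_simpleGraph_le (n : ℕ) : Nat.card (SimpleGraph (Fin n)) ≤ 2 ^ n.choose 2 := by
  classical
  have hinj : Function.Injective fun G : SimpleGraph (Fin n) =>
      {e : {e : Sym2 (Fin n) // ¬e.IsDiag} | e.1 ∈ G.edgeSet} := fun G H h => by
    refine SimpleGraph.edgeSet_injective (Set.ext fun e => ?_)
    by_cases he : e.IsDiag
    · exact iff_of_false (fun h' => G.not_isDiag_of_mem_edgeSet h' he)
        fun h' => H.not_isDiag_of_mem_edgeSet h' he
    · exact Set.ext_iff.1 h ⟨e, he⟩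
  refine (Nat.card_le_card_of_injective _ hinj).trans_eq ?_
  rw [Nat.card_eq_fintype_card, Fintype.card_set, Sym2.card_subtype_not_diag, Fintype.card_fin]

lemma almostAllGraphs_of_tendsto_uniformProb {P : (n : ℕ) → SimpleGraph (Fin n) → Prop}
    (h : Tendsto (fun n => uniformProb fun G => ¬P n G) atTop (𝓝 0)) : AlmostAllGraphs P := by
  refine squeeze_zero (fun n => by positivity) (fun n => ?_) h
  unfold uniformProb
  gcongr
  · exact Nat.cast_pos.2 Nat.card_pos
  · exact_mod_cast natCard_simpleGraph_le n

lemma AlmostAllGraphs.mono_eventually {P Q : (n : ℕ) → SimpleGraph (Fin n) → Prop}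
    (hP : AlmostAllGraphs P) (h : ∀ᶠ n in atTop, ∀ G, P n G → Q n G) : AlmostAllGraphs Q := by
  refine squeeze_zero' (Eventually.of_forall fun n => by positivity) ?_ hP
  filter_upwards [h] with n hn
  gcongr
  · exact Set.toFinite _
  · exact fun hG => hn _ hG

lemma card_le_of_neighborDegreesSeparate {V : Type*} [Fintype V] {G : SimpleGraph V}
    (hG : NeighborDegreesSeparate G) : Fintype.card V ≤ 2 * G.edgeSet.ncard + 1 := by
  classical
  have hisolated : #{v | G.degree v = 0} ≤ 1 := by
    refine card_le_one.2 fun u hu v hv => hG ?_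
    rw [mem_filter_univ, ← SimpleGraph.card_neighborFinset_eq_degree, card_eq_zero] at hu hv
    simp only [neighborDegrees, hu, hv]
  have hdegree : #{v | ¬G.degree v = 0} ≤ ∑ v, G.degree v := by
    rw [card_filter]
    exact sum_le_sum fun v _ => by split_ifs <;> lia
  have hsum : ∑ v, G.degree v = 2 * G.edgeSet.ncard := by
    rw [G.sum_degrees_eq_twice_card_edges, ← SimpleGraph.coe_edgeFinset, Set.ncard_coe_finset]
  calc Fintype.card V = #{v | G.degree v = 0} + #{v | ¬G.degree v = 0} := by
        rw [card_filter_add_card_filter_not, card_univ]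
    _ ≤ 2 * G.edgeSet.ncard + 1 := by lia

section Estimates

variable {m n : ℕ}

lemma degreeClass_term_le (hm : 0 < m) (hlow : m ^ 16 ≤ n) (hup : n + 2 ≤ (2 * m) ^ 16) :
    ((n + 2) ^ 2 * (1 / ((m ^ 14) ^ 2 * √n)) : ℝ) ≤ 2 ^ 32 / m := by
  have hsqrt : (m ^ 8 : ℝ) ≤ √n := Real.le_sqrt_of_sq_le (by rw [← pow_mul]; exact_mod_cast hlow)
  have hup' : (n + 2 : ℝ) ≤ (2 * m) ^ 16 := by exact_mod_cast hup
  have hm' : (1 : ℝ) ≤ m := by exact_mod_cast hm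
  calc ((n + 2) ^ 2 * (1 / ((m ^ 14) ^ 2 * √n)) : ℝ)
      ≤ ((2 * m) ^ 16) ^ 2 * (1 / ((m ^ 14) ^ 2 * m ^ 8)) := by gcongr
    _ = 2 ^ 32 / m ^ 4 := by field_simp
    _ ≤ 2 ^ 32 / m := by gcongr; exact le_self_pow₀ hm' (by norm_num)

lemma exclusiveNeighbors_term_le (hm : 2 ≤ m) (hexp : (2 * m) ^ 64 ≤ 2 ^ m) (hlow : m ^ 16 ≤ n)
    (hup : n + 2 ≤ (2 * m) ^ 16) :
    ((n + 2) ^ 2 * ((m * m ^ 14 : ℕ) * n ^ (m * m ^ 14) / 2 ^ n) : ℝ) ≤ 1 / m := by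
  have hpow : 2 ^ 15 ≤ m ^ 15 := Nat.pow_le_pow_left hm 15
  have hnat : m * ((n + 2) ^ 2 * (m ^ 15 * n ^ m ^ 15)) ≤ 2 ^ n := by
    calc m * ((n + 2) ^ 2 * (m ^ 15 * n ^ m ^ 15))
        ≤ (n + 2) * ((n + 2) ^ 2 * ((n + 2) * (n + 2) ^ m ^ 15)) := by
          gcongr
          · exact ((Nat.le_self_pow (by norm_num) m).trans hlow).trans (by lia)
          · exact ((Nat.pow_le_pow_right (by lia) (by norm_num)).trans hlow).trans (by lia)
          · lia
      _ = (n + 2) ^ (m ^ 15 + 4) := by ring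
      _ ≤ ((2 * m) ^ 16) ^ (m ^ 15 + 4) := by gcongr
      _ = (2 * m) ^ (16 * (m ^ 15 + 4)) := by rw [pow_mul]
      _ ≤ (2 * m) ^ (64 * m ^ 15) := Nat.pow_le_pow_right (by lia) (by lia)
      _ = ((2 * m) ^ 64) ^ m ^ 15 := by rw [pow_mul]
      _ ≤ (2 ^ m) ^ m ^ 15 := by gcongr
      _ = 2 ^ m ^ 16 := by rw [← pow_mul, ← pow_succ']
      _ ≤ 2 ^ n := Nat.pow_le_pow_right (by norm_num) hlow
  rw [← pow_succ', ← mul_div_assoc, div_le_div_iff₀ (by positivity) (by positivity), one_mul,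
    mul_comm _ (m : ℝ)]
  exact_mod_cast hnat

lemma collision_term_le (hm : 0 < m) (hexp : (2 * m) ^ 64 ≤ 2 ^ m) (hup : n + 2 ≤ (2 * m) ^ 16) :
    ((n + 2) ^ 2 * (1 / 2 ^ m) : ℝ) ≤ 1 / m := by
  have hnat : (n + 2) ^ 2 * m ≤ 2 ^ m := by
    calc (n + 2) ^ 2 * m ≤ ((2 * m) ^ 16) ^ 2 * (2 * m) := by gcongr; lia
      _ = (2 * m) ^ 33 := by ring
      _ ≤ (2 * m) ^ 64 := Nat.pow_le_pow_right (by lia) (by norm_num)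
      _ ≤ 2 ^ m := hexp
  rw [mul_one_div, div_le_div_iff₀ (by positivity) (by positivity), one_mul]
  exact_mod_cast hnat

lemma eventually_two_mul_pow_le_two_pow (k : ℕ) : ∀ᶠ m : ℕ in atTop, (2 * m) ^ k ≤ 2 ^ m := by
  have h := tendsto_pow_const_div_const_pow_of_one_lt k one_lt_two
  filter_upwards [h.eventually_le_const (show (0 : ℝ) < 1 / 2 ^ k by positivity)] with m hm
  rw [div_le_div_iff₀ (by positivity) (by positivity), one_mul] at hm
  rw [mul_pow, mul_comm]
  exact_mod_cast hm

end Estimates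

-- With `m ≈ n ^ (1 / 16)`, degree classes have at most `m ^ 14` vertices, and exclusive
-- neighborhoods at least `m ^ 15`, hence at least `m` degrees.
lemma tendsto_uniformProb_not_neighborDegreesSeparate :
    Tendsto (fun n => uniformProb fun G : SimpleGraph (Fin n) => ¬NeighborDegreesSeparate G)
      atTop (𝓝 0) := by
  rw [← tendsto_add_atTop_iff_nat 2]
  let m (n : ℕ) := Nat.nthRoot 16 n
  have hm : Tendsto m atTop atTop := tendsto_atTop.2 fun b => by
    filter_upwards [eventually_ge_atTop (b ^ 16)] with n hn
    exact (Nat.le_nthRoot_iff (by norm_num)).2 hn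
  have hlim : Tendsto (fun n => (2 ^ 32 + 2) / (m n : ℝ)) atTop (𝓝 0) :=
    (tendsto_const_div_atTop_nhds_zero_nat _).comp hm
  refine squeeze_zero' (Eventually.of_forall fun n => by unfold uniformProb; positivity) ?_ hlim
  filter_upwards [hm.eventually_ge_atTop 2, hm.eventually (eventually_two_mul_pow_le_two_pow 64),
    eventually_gt_atTop 0] with n hm2 hexp hn
  have : NeZero n := ⟨hn.ne'⟩
  have hlow : m n ^ 16 ≤ n := Nat.pow_nthRoot_le (.inl (by norm_num))
  have hup : n + 2 ≤ (2 * m n) ^ 16 := by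
    have : n < (m n + 1) ^ 16 := Nat.lt_pow_nthRoot_add_one (by norm_num) n
    have : (m n + 1) ^ 16 < (2 * m n) ^ 16 := Nat.pow_lt_pow_left (by lia) (by norm_num)
    lia
  refine (uniformProb_not_neighborDegreesSeparate_le (Fintype.card_fin (n + 2))
    (c := m n ^ 14) (by positivity) (m n)).trans ?_
  have h1 := degreeClass_term_le (by lia) hlow hup
  have h2 := exclusiveNeighbors_term_le hm2 hexp hlow hup
  have h3 := collision_term_le (by lia) hexp hup
  rw [Fintype.card_fin, mul_add, mul_add, add_div]
  push_cast at h1 h2 h3 ⊢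
  linarith [show (2 : ℝ) / m n = 1 / m n + 1 / m n by ring]

lemma almostAllGraphs_neighborDegreesSeparate :
    AlmostAllGraphs fun _ G => NeighborDegreesSeparate G :=
  almostAllGraphs_of_tendsto_uniformProb tendsto_uniformProb_not_neighborDegreesSeparate

end AlmostAll

section MPNN

lemma exists_injective_multiset (E : Type*) [Infinite E] :
    ∃ g : Multiset E → E, Function.Injective g := by
  obtain ⟨g⟩ := Cardinal.le_def _ _ |>.1 (Cardinal.mk_multiset_of_infinite E).le
  exact ⟨g, g.injective⟩

/-- The two-layer network of width `1` whose layers encode the multiset of the neighbors' features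
by `g`, with edge readout `r`. -/
def twoLayerMPNN (g : Multiset (EuclideanSpace ℝ (Fin 1)) → EuclideanSpace ℝ (Fin 1))
    (r : Sym2 (EuclideanSpace ℝ (Fin 1)) → ℝ) : UpstreamMPNN 1 where
  depth := 2
  upd _ _ a := a
  agg _ := g
  edgeReadout := r

variable {n : ℕ} {G : SimpleGraph (Fin n)}
  {g : Multiset (EuclideanSpace ℝ (Fin 1)) → EuclideanSpace ℝ (Fin 1)}

lemma twoLayerMPNN_feature_two_injective (hG : NeighborDegreesSeparate G)
    (hg : Function.Injective g) (r : Sym2 (EuclideanSpace ℝ (Fin 1)) → ℝ) :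
    Function.Injective ((twoLayerMPNN g r).feature G 2) := by
  let c (k : ℕ) : EuclideanSpace ℝ (Fin 1) := g (.replicate k (WithLp.toLp 2 fun _ => 1))
  have hc : Function.Injective c := hg.comp (Multiset.replicate_left_injective _)
  have hfeature : (twoLayerMPNN g r).feature G 2 =
      fun v => g ((neighborDegrees G v).map c) := by
    funext v
    simp only [UpstreamMPNN.feature, twoLayerMPNN, neighborDegrees, c, Multiset.map_map,
      Multiset.map_const', Finset.card_val, SimpleGraph.card_neighborFinset_eq_degree,
      Function.comp_def]
  rw [hfeature]
  exact hg.comp ((Multiset.map_injective hc).comp hG)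

lemma exists_priors_eq (hG : NeighborDegreesSeparate G) {θ : Fin n → Fin n → ℝ}
    (hθ : ∀ i j, θ i j = θ j i) : ∃ U : UpstreamMPNN 1, U.priors G = θ := by
  obtain ⟨g, hg⟩ := exists_injective_multiset (EuclideanSpace ℝ (Fin 1))
  have hφ := twoLayerMPNN_feature_two_injective hG hg 0
  let r := Function.extend (Sym2.map ((twoLayerMPNN g 0).feature G 2)) (Sym2.lift ⟨θ, hθ⟩) 0
  refine ⟨twoLayerMPNN g r, funext₂ fun i j => ?_⟩
  exact (Sym2.map.injective hφ).extend_apply _ _ s(i, j)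

variable {m : ℕ} (U : UpstreamMPNN m) (τ : Equiv.Perm (Fin n))

open Classical in
lemma neighborFinset_comap_map (v : Fin n) :
    ((G.comap τ).neighborFinset v).map τ.toEmbedding = G.neighborFinset (τ v) := by
  ext w
  obtain ⟨w, rfl⟩ := τ.surjective w
  simp

lemma feature_comap (t : ℕ) (v : Fin n) :
    U.feature (G.comap τ) t v = U.feature G t (τ v) := by
  classical
  induction t generalizing v with
  | zero => rfl
  | succ t ih =>
    simp only [UpstreamMPNN.feature, ← neighborFinset_comap_map, Finset.map_val, Multiset.map_map,
      Function.comp_def, Equiv.coe_toEmbedding, ih]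
    congr!

lemma priors_comap (i j : Fin n) : U.priors (G.comap τ) i j = U.priors G (τ i) (τ j) := by
  simp only [UpstreamMPNN.priors, feature_comap]

end MPNN

section Concentration

variable {n : ℕ}

open Classical in
/-- The priors that are `M` on the edges of `S` and `-M` elsewhere. -/
def sharpPriors (S : SimpleGraph (Fin n)) (M : ℝ) : Fin n → Fin n → ℝ :=
  fun i j => if S.Adj i j then M else -M

open Classical in
lemma sharpPriors_comm (S : SimpleGraph (Fin n)) (M : ℝ) (i j : Fin n) :
    sharpPriors S M i j = sharpPriors S M j i :=
  if_congr (S.adj_comm i j) rfl rfl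

open Classical in
lemma tendsto_edgeWeight_sharpPriors (S B : SimpleGraph (Fin n)) :
    Tendsto (fun M => edgeWeight (sharpPriors S M) B) atTop (𝓝 (if B = S then 1 else 0)) := by
  have hlim : (∏ i, ∏ j, if (B.Adj i j ↔ S.Adj i j) then (1 : ℝ) else 0) =
      if B = S then 1 else 0 := by
    simp only [prod_boole, mem_univ, true_imp_iff, SimpleGraph.ext_iff, funext_iff, eq_iff_iff]
  have h1 := Real.tendsto_sigmoid_atTop
  have h0 : Tendsto (fun M => 1 - Real.sigmoid M) atTop (𝓝 0) := by simpa using h1.const_sub 1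
  rw [← hlim]
  refine tendsto_finsetProd _ fun i _ => tendsto_finsetProd _ fun j _ => ?_
  by_cases hB : B.Adj i j <;> by_cases hS : S.Adj i j <;>
    simpa [sharpPriors, hB, hS, Real.sigmoid_neg]

open Classical in
lemma tendsto_exactlyK_sharpPriors {C S : SimpleGraph (Fin n)} (hSC : S ≤ C) :
    Tendsto (fun M => exactlyK C (sharpPriors S M) S.edgeSet.ncard S) atTop (𝓝 1) := by
  have hsum : Tendsto (fun M => ∑ B : SimpleGraph (Fin n) with
      B ≤ C ∧ B.edgeSet.ncard = S.edgeSet.ncard, edgeWeight (sharpPriors S M) B) atTop (𝓝 1) := by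
    simpa [Finset.sum_ite_eq', hSC] using
      tendsto_finsetSum {B | B ≤ C ∧ B.edgeSet.ncard = S.edgeSet.ncard}
        fun B _ => tendsto_edgeWeight_sharpPriors S B
  simpa [exactlyK, hSC, Pi.div_def] using (tendsto_edgeWeight_sharpPriors S S).div hsum one_ne_zero

lemma exists_sharpPriors_concentrate (n : ℕ) {δ : ℝ} (hδ : 0 < δ) :
    ∃ M, ∀ C S : SimpleGraph (Fin n), S ≤ C →
      1 - δ ≤ exactlyK C (sharpPriors S M) S.edgeSet.ncard S := by
  refine Eventually.exists (f := atTop) (eventually_all.2 fun C => eventually_all.2 fun S => ?_)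
  by_cases hSC : S ≤ C
  · filter_upwards [(tendsto_exactlyK_sharpPriors hSC).eventually_const_le (sub_lt_self 1 hδ)]
      with M hM _ using hM
  · exact Eventually.of_forall fun M h => absurd h hSC

lemma edgeWeight_pos (θ : Fin n → Fin n → ℝ) (S : SimpleGraph (Fin n)) : 0 < edgeWeight θ S := by
  refine prod_pos fun i _ => prod_pos fun j _ => ?_
  split_ifs
  · exact Real.sigmoid_pos _
  · exact sub_pos.2 (Real.sigmoid_lt_one _)

lemma exactlyK_nonneg (C : SimpleGraph (Fin n)) (θ : Fin n → Fin n → ℝ) (k : ℕ)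
    (S : SimpleGraph (Fin n)) : 0 ≤ exactlyK C θ k S := by
  unfold exactlyK
  split_ifs
  · exact div_nonneg (edgeWeight_pos θ S).le (sum_nonneg fun B _ => (edgeWeight_pos θ B).le)
  · rfl

open Classical in
lemma sum_exactlyK_le_one (C : SimpleGraph (Fin n)) (θ : Fin n → Fin n → ℝ) (k : ℕ) :
    ∑ S, exactlyK C θ k S ≤ 1 := by
  simp only [exactlyK, ← sum_filter, ← sum_div]
  exact div_self_le_one _

end Concentration

section SeparationProb

variable {n d : ℕ} {f : SimpleGraph (Fin n) → EuclideanSpace ℝ (Fin d)}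
  {G H S T : SimpleGraph (Fin n)}

open Classical in
lemma separationProb_le {p q : SimpleGraph (Fin n) → ℝ} (hp : ∀ A, 0 ≤ p A) (hq : ∀ B, 0 ≤ q B)
    (hp1 : ∑ A, p A ≤ 1) (hq1 : ∑ B, q B ≤ 1) (hf : f (G \ S) = f (H \ T)) :
    separationProb f G H p q ≤ 1 - p S * q T := by
  calc separationProb f G H p q
      = ∑ x ∈ univ.erase (S, T),
          p x.1 * q x.2 * (if f (G \ x.1) ≠ f (H \ x.2) then 1 else 0) := by
        rw [separationProb, ← Fintype.sum_prod_type', sum_erase _ (by simp [hf])]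
    _ ≤ ∑ x ∈ univ.erase (S, T), p x.1 * q x.2 := by
        refine sum_le_sum fun x _ => mul_le_of_le_one_right (mul_nonneg (hp _) (hq _)) ?_
        split_ifs <;> norm_num
    _ = (∑ A, p A) * (∑ B, q B) - p S * q T := by
        rw [sum_erase_eq_sub (mem_univ _), Fintype.sum_mul_sum, Fintype.sum_prod_type]
    _ ≤ 1 - p S * q T := by
        gcongr
        exact mul_le_one₀ hp1 (sum_nonneg fun B _ => hq B) hq1

lemma separationProb_exactlyK_le {C D : SimpleGraph (Fin n)} {θ η : Fin n → Fin n → ℝ} {k : ℕ}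
    {ε : ℝ} (hε : ε ≤ 1) (hS : 1 - ε / 2 ≤ exactlyK C θ k S) (hT : 1 - ε / 2 ≤ exactlyK D η k T)
    (hf : f (G \ S) = f (H \ T)) :
    separationProb f G H (exactlyK C θ k) (exactlyK D η k) ≤ ε := by
  refine (separationProb_le (exactlyK_nonneg C θ k) (exactlyK_nonneg D η k)
    (sum_exactlyK_le_one C θ k) (sum_exactlyK_le_one D η k) hf).trans ?_
  have hST := mul_le_mul hS hT (by linarith) (exactlyK_nonneg C θ k S)
  nlinarith [sq_nonneg ε]

lemma exists_le_edgeSet_ncard_eq {k : ℕ} (hk : k ≤ G.edgeSet.ncard) :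
    ∃ S ≤ G, S.edgeSet.ncard = k := by
  obtain ⟨t, ht, rfl⟩ := Set.exists_subset_card_eq hk
  have hdiag : Disjoint t Sym2.diagSet :=
    Set.disjoint_left.2 fun e he => G.not_isDiag_of_mem_edgeSet (ht he)
  have hedge : (SimpleGraph.fromEdgeSet t).edgeSet = t := by
    rw [SimpleGraph.edgeSet_fromEdgeSet, sdiff_eq_left.2 hdiag]
  exact ⟨.fromEdgeSet t, SimpleGraph.edgeSet_subset_edgeSet.1 (hedge.symm ▸ ht), by rw [hedge]⟩

lemma edgeSet_ncard_comap (τ : Equiv.Perm (Fin n)) :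
    (S.comap τ).edgeSet.ncard = S.edgeSet.ncard :=
  Nat.card_congr (SimpleGraph.Iso.comap τ S).mapEdgeSet

lemma exists_comap_eq_of_iso (e : G ≃g H) : ∃ τ : Equiv.Perm (Fin n), H = G.comap τ :=
  ⟨e.symm.toEquiv, by ext a b; exact e.symm.map_adj_iff.symm⟩

lemma exists_separationProb_le {k : ℕ} {ε : ℝ} (hε : 0 < ε) (hG : NeighborDegreesSeparate G)
    (hk : k ≤ G.edgeSet.ncard) :
    ∃ U : UpstreamMPNN 1, ∀ H, Nonempty (G ≃g H) →
      ∀ (d : ℕ) (f : SimpleGraph (Fin n) → EuclideanSpace ℝ (Fin d)), PermInvariant f →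
        separationProb f G H (exactlyK G (U.priors G) k) (exactlyK H (U.priors H) k) ≤ ε ∧
        separationProb f G H (exactlyK ⊤ (U.priors G) k) (exactlyK ⊤ (U.priors H) k) ≤ ε := by
  obtain ⟨S, hSG, rfl⟩ := exists_le_edgeSet_ncard_eq hk
  obtain ⟨M, hM⟩ := exists_sharpPriors_concentrate n (show 0 < min ε 1 / 2 by positivity)
  obtain ⟨U, hU⟩ := exists_priors_eq hG (sharpPriors_comm S M)
  refine ⟨U, fun H ⟨e⟩ d f hf => ?_⟩
  obtain ⟨τ, rfl⟩ := exists_comap_eq_of_iso e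
  have hUτ : U.priors (G.comap τ) = sharpPriors (S.comap τ) M :=
    funext₂ fun i j => by rw [priors_comap, hU]; rfl
  have hfST : f (G \ S) = f (G.comap τ \ S.comap τ) := (hf τ (G \ S)).symm
  have hsep {C D : SimpleGraph (Fin n)} (hSC : S ≤ C) (hSD : S.comap τ ≤ D) :
      separationProb f G (G.comap τ) (exactlyK C (U.priors G) S.edgeSet.ncard)
        (exactlyK D (U.priors (G.comap τ)) S.edgeSet.ncard) ≤ ε := by
    rw [hU, hUτ]
    refine (separationProb_exactlyK_le (min_le_right ε 1) (hM C S hSC) ?_ hfST).trans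
      (min_le_left ε 1)
    rw [← edgeSet_ncard_comap τ]
    exact hM D _ hSD
  exact ⟨hsep hSG (SimpleGraph.comap_monotone τ.toEmbedding hSG), hsep le_top le_top⟩

end SeparationProb

end PRMPNN

end

open PRMPNN in
theorem theorem4p1_general :
    (∀ k : ℕ, AlmostAllGraphs fun _ G => k ≤ G.edgeSet.ncard) ∧
    AlmostAllGraphs fun n G =>
      ∀ ε : ℝ, 0 < ε → ∀ k ≤ G.edgeSet.ncard,
        ∃ U : UpstreamMPNN 1, ∀ H, Nonempty (G ≃g H) →
          ∀ (d : ℕ) (f : SimpleGraph (Fin n) → EuclideanSpace ℝ (Fin d)), PermInvariant f →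
            separationProb f G H (exactlyK G (U.priors G) k) (exactlyK H (U.priors H) k) ≤ ε ∧
            separationProb f G H (exactlyK ⊤ (U.priors G) k) (exactlyK ⊤ (U.priors H) k) ≤ ε := by
  refine ⟨fun k => almostAllGraphs_neighborDegreesSeparate.mono_eventually ?_,
    almostAllGraphs_neighborDegreesSeparate.mono_eventually (.of_forall fun n G hG ε hε k hk =>
      exists_separationProb_le hε hG hk)⟩
  filter_upwards [eventually_ge_atTop (2 * k)] with n hn G hG
  have := Fintype.card_fin n ▸ card_le_of_neighborDegreesSeparate hG
  lia

open PRMPNN in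
theorem theorem4p1 :
    (∀ k : ℕ, AlmostAllGraphs (fun _ G => k ≤ G.edgeSet.ncard)) ∧
    AlmostAllGraphs (fun n G =>
      ∀ ε : ℝ, 0 < ε → ε < 1 →
      ∀ k : ℕ, 0 < k → k ≤ G.edgeSet.ncard →
      ∀ H : SimpleGraph (Fin n), Nonempty (G ≃g H) →
      ∀ d : ℕ, 0 < d →
      ∀ f : SimpleGraph (Fin n) → EuclideanSpace ℝ (Fin d), PermInvariant f → WLEquivalent f →
        ∃ m : ℕ, 0 < m ∧ ∃ U : UpstreamMPNN m,
          separationProb f G H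
            (exactlyK G (U.priors G) k) (exactlyK H (U.priors H) k) ≤ ε ∧
          separationProb f G H
            (exactlyK ⊤ (U.priors G) k) (exactlyK ⊤ (U.priors H) k) ≤ ε) := by
  exact theorem4p1_general.imp_right fun h => h.mono_eventually <| .of_forall
    fun _ _ hG ε hε _ k _ hk H hGH d _ f hf _ =>
      have ⟨U, hU⟩ := hG ε hε k hk
      ⟨1, one_pos, U, hU H hGH d f hf⟩
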